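/- Let $d\ge 1$, let $\mathbb{D}=\{\zeta\in\mathbb{C}:|\zeta|<1\}$ and $\mathbb{T}=\{\zeta\in\mathbb{C}:|\zeta|=1\}$, let $S\subset\mathbb{D}^d$ be a finite set with $n$ elements, and let $f:S\to\mathbb{C}$ be a function. For a $d$-tuple $T=(T_1,\dots,T_d)$ of commuting, simultaneously diagonalizable $k\times k$ complex matrices ($k$ arbitrary), let $\sigma(T)$ be the set of joint eigenvalues, i.e. of those $z\in\mathbb{C}^d$ whose joint eigenspace $\{v\in\mathbb{C}^k: T_jv=z_jv,\ j=1,\dots,d\}$ is nonzero; if $\sigma(T)\subset S$, let $f(T)$ be the unique matrix with $f(T)v=f(z)v$ for every $z\in\sigma(T)$ and every $v$ in the joint eigenspace of $T$ at $z$. Matrices carry the operator norm on Euclidean $\mathbb{C}^k$, and $T$ is contractive if $\|T_j\|\le1$ for all $j$. The following are equivalent. (1) $\|f(T)\|\le 1$ for every $d$-tuple $T$ of commuting, contractive, simultaneously diagonalizable matrices (of any size) whose joint eigenspaces at the points of $\sigma(T)$ all have dimension $1$ and for which $\sigma(T)\subset S$. (2) There exist positive semidefinite $n\times n$ matrices $A^1,\dots,A^d$,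 with rows and columns indexed by $S$, such that for all $z,w\in S$ $$1-\overline{f(w)}f(z)=\sum_{j=1}^d(1-\bar w_jz_j)A^j_{z,w}.$$ (3) There exists a rational inner function $\phi$ on $\mathbb{D}^d$, that is, $\phi=Q/R$ with polynomials $Q,R\in\mathbb{C}[z_1,\dots,z_d]$ such that $R(z)\ne0$ for $z\in\mathbb{D}^d$ and $|R(z)|=|Q(z)|$ for $z\in\mathbb{T}^d$, such that $\phi$ either maps $\mathbb{D}^d$ into $\mathbb{D}$ or is a constant of modulus $1$, such that $\phi(z)=f(z)$ for all $z\in S$, and such that there are positive semidefinite kernels $K^1,\dots,K^d:\mathbb{D}^d\times\mathbb{D}^d\to\mathbb{C}$ with $$1-\overline{\phi(w)}\phi(z)=\sum_{j=1}^d(1-\bar w_jz_j)K^j(z,w)\qquad\text{for all }z,w\in\mathbb{D}^d.$$ -/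

import Mathlib

open scoped ComplexOrder

namespace AglerPick

/-- The open unit polydisk `𝔻^d` in `ℂ^d`. -/
def polydisk (d : ℕ) : Set (Fin d → ℂ) := {z | ∀ j, ‖z j‖ < 1}

/-- The `d`-torus `𝕋^d` in `ℂ^d`. -/
def torus (d : ℕ) : Set (Fin d → ℂ) := {z | ∀ j, ‖z j‖ = 1}

/-- The operators on the Hilbert space `ℂ^k` (with its Euclidean norm), that is, the `k × k`
matrices; the norm is the operator norm. -/
abbrev Op (k : ℕ) : Type := EuclideanSpace ℂ (Fin k) →L[ℂ] EuclideanSpace ℂ (Fin k)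

/-- The joint eigenspace `{v | T_j v = z_j v for all j}` of a `d`-tuple at the point `z`. -/
def jointEigenspace {d k : ℕ} (T : Fin d → Op k) (z : Fin d → ℂ) :
    Submodule ℂ (EuclideanSpace ℂ (Fin k)) :=
  ⨅ j, Module.End.eigenspace (T j : Module.End ℂ (EuclideanSpace ℂ (Fin k))) (z j)

/-- The joint spectrum `σ(T)`: the set of joint eigenvalues. -/
def jointSpectrum {d k : ℕ} (T : Fin d → Op k) : Set (Fin d → ℂ) :=
  {z | jointEigenspace T z ≠ ⊥}

/-- `T` is simultaneously diagonalizable: some (not necessarily orthogonal) basis consists of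
eigenvectors of every `T_j`. -/
def SimultaneouslyDiagonalizable {d k : ℕ} (T : Fin d → Op k) : Prop :=
  ∃ b : Module.Basis (Fin k) ℂ (EuclideanSpace ℂ (Fin k)),
    ∀ i j, ∃ c : ℂ, T j (b i) = c • b i

/-- The tuples used for testing: commuting, contractive, simultaneously diagonalizable `d`-tuples
of matrices whose joint eigenspaces (at the points of the joint spectrum) are one-dimensional. -/
structure IsSimpleDiagonalizableContraction {d k : ℕ} (T : Fin d → Op k) : Prop where
  commute : ∀ i j, Commute (T i) (T j)
  contractive : ∀ j, ‖T j‖ ≤ 1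
  diagonalizable : SimultaneouslyDiagonalizable T
  finrank_eq_one : ∀ z ∈ jointSpectrum T, Module.finrank ℂ (jointEigenspace T z) = 1

/-- `F` acts as the scalar `f z` on the joint eigenspace of `T` at each point `z` of `S`. -/
def IsFunctionOf {d k : ℕ} (S : Finset (Fin d → ℂ)) (f : S → ℂ) (T : Fin d → Op k)
    (F : Op k) : Prop :=
  ∀ z : S, ∀ v ∈ jointEigenspace T z, F v = f z • v

open Classical in
/-- The operator `f(T)`, acting as the scalar `f z` on the joint eigenspace of `T` at `z ∈ S`. It
exists and is unique when `T` is simultaneously diagonalizable with `σ(T) ⊆ S`, see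
`existsUnique_isFunctionOf`; the default value `0` is not used for such tuples. -/
noncomputable def applyFun {d k : ℕ} (S : Finset (Fin d → ℂ)) (f : S → ℂ) (T : Fin d → Op k) :
    Op k :=
  if h : ∃ F : Op k, IsFunctionOf S f T F then h.choose else 0

theorem mem_jointEigenspace {d k : ℕ} (T : Fin d → Op k) (z : Fin d → ℂ)
    (v : EuclideanSpace ℂ (Fin k)) :
    v ∈ jointEigenspace T z ↔ ∀ j, T j v = z j • v := by
  simp [jointEigenspace]

theorem existsUnique_isFunctionOf {d k : ℕ} (S : Finset (Fin d → ℂ)) (f : S → ℂ)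
    (T : Fin d → Op k) (hT : SimultaneouslyDiagonalizable T)
    (hS : jointSpectrum T ⊆ (S : Set (Fin d → ℂ))) :
    ∃! F : Op k, IsFunctionOf S f T F := by
  classical
  obtain ⟨b, hb⟩ := hT
  choose c hc using hb
  have hmem : ∀ i, b i ∈ jointEigenspace T (c i) := fun i =>
    (mem_jointEigenspace T _ _).2 (hc i)
  have hcS : ∀ i, c i ∈ S := fun i => hS fun h => b.ne_zero i (by
    have := hmem i
    rwa [h, Submodule.mem_bot] at this)
  refine ⟨LinearMap.toContinuousLinearMap
    (b.constr ℂ fun i => f ⟨c i, hcS i⟩ • b i), ?_, ?_⟩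
  · rintro z v hv
    rw [mem_jointEigenspace] at hv
    have key : ∀ i, b.repr v i ≠ 0 → c i = z := by
      intro i hi
      funext j
      have h1 : T j v = ∑ l, (b.repr v l * c l j) • b l := by
        conv_lhs => rw [← b.sum_repr v, map_sum]
        exact Finset.sum_congr rfl fun l _ => by rw [map_smul, hc, smul_smul]
      have h2 : b.repr (T j v) i = b.repr v i * c i j := by
        rw [h1, b.repr_sum_self]
      rw [hv j] at h2
      simp only [map_smul, Finsupp.smul_apply, smul_eq_mul] at h2
      exact (mul_left_cancel₀ hi (by rw [← h2, mul_comm]))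
    change (b.constr ℂ fun i => f ⟨c i, hcS i⟩ • b i) v = f z • v
    rw [Module.Basis.constr_apply_fintype]
    conv_rhs => rw [← b.sum_repr v, Finset.smul_sum]
    refine Finset.sum_congr rfl fun i _ => ?_
    by_cases hi : b.repr v i = 0
    · simp [Module.Basis.equivFun_apply, hi]
    · have hz : (⟨c i, hcS i⟩ : S) = z := Subtype.ext (key i hi)
      rw [hz, Module.Basis.equivFun_apply, smul_comm]
  · intro G hG
    ext1 v
    have : (G : EuclideanSpace ℂ (Fin k) →ₗ[ℂ] EuclideanSpace ℂ (Fin k)) =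
        b.constr ℂ fun i => f ⟨c i, hcS i⟩ • b i := by
      refine b.ext fun i => ?_
      rw [Module.Basis.constr_basis]
      exact hG ⟨c i, hcS i⟩ (b i) (hmem i)
    exact LinearMap.congr_fun this v

theorem isFunctionOf_applyFun {d k : ℕ} (S : Finset (Fin d → ℂ)) (f : S → ℂ)
    (T : Fin d → Op k) (hT : SimultaneouslyDiagonalizable T)
    (hS : jointSpectrum T ⊆ (S : Set (Fin d → ℂ))) :
    IsFunctionOf S f T (applyFun S f T) := by
  have h := (existsUnique_isFunctionOf S f T hT hS).exists
  rw [applyFun, dif_pos h]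
  exact h.choose_spec

/-- `φ` is a rational inner function on the polydisk: `φ = Q / R` with polynomials `Q`, `R` such
that `R` has no zero on `𝔻^d` and `|R| = |Q|` on `𝕋^d`. -/
def IsRationalInner {d : ℕ} (φ : polydisk d → ℂ) : Prop :=
  ∃ Q R : MvPolynomial (Fin d) ℂ,
    (∀ z ∈ polydisk d, MvPolynomial.eval z R ≠ 0) ∧
    (∀ z ∈ torus d, ‖MvPolynomial.eval z R‖ = ‖MvPolynomial.eval z Q‖) ∧
    ∀ z : polydisk d,
      φ z = MvPolynomial.eval (z : Fin d → ℂ) Q / MvPolynomial.eval (z : Fin d → ℂ) R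

/-- `φ` has an Agler decomposition with positive semidefinite kernels `K_1, …, K_d` on
`𝔻^d × 𝔻^d` (every finite section of each `K_j` is a positive semidefinite matrix). -/
def HasAglerDecomposition {d : ℕ} (φ : polydisk d → ℂ) : Prop :=
  ∃ K : Fin d → Matrix (polydisk d) (polydisk d) ℂ,
    (∀ j, (K j).PosSemidef) ∧
    ∀ z w : polydisk d, 1 - star (φ w) * φ z =
      ∑ j, (1 - star ((w : Fin d → ℂ) j) * (z : Fin d → ℂ) j) * K j z w

end AglerPick

namespace AglerPick

open Matrix

/-- A positive semidefinite matrix is the Gram matrix of a family of coordinate vectors. -/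
theorem _root_.Matrix.PosSemidef.exists_dotProduct_star {ι : Type*} [Fintype ι]
    {A : Matrix ι ι ℂ} (hA : A.PosSemidef) :
    ∃ u : ι → ι → ℂ, ∀ z w, A z w = star (u w) ⬝ᵥ u z := by
  classical
  open scoped MatrixOrder in
  obtain ⟨B, hB⟩ := CStarAlgebra.nonneg_iff_eq_star_mul_self.mp hA.nonneg
  refine ⟨fun z s => star (B s z), fun z w => ?_⟩
  rw [hB]
  simp only [star_eq_conjTranspose, mul_apply, conjTranspose_apply, dotProduct, Pi.star_apply,
    star_star]
  exact Finset.sum_congr rfl fun _ _ => mul_comm _ _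

theorem posSemidef_of_dotProduct_star {ι n : Type*} [Fintype n] (u : ι → n → ℂ) :
    (Matrix.of fun z w => star (u w) ⬝ᵥ u z).PosSemidef := by
  refine ⟨IsHermitian.ext fun z w => ?_, fun x => ?_⟩
  · simp [dotProduct, mul_comm]
  have : (x.sum fun i xi => x.sum fun j xj => star xi *
      (Matrix.of fun z w => star (u w) ⬝ᵥ u z) i j * xj) =
      ∑ s, (x.sum fun i xi => star xi * u i s) * star (x.sum fun i xi => star xi * u i s) := by
    simp only [Finsupp.sum, of_apply, dotProduct, Pi.star_apply, star_sum,
      Finset.mul_sum, Finset.sum_mul, star_mul', star_star]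
    conv_lhs => rw [Finset.sum_comm]
    rw [Finset.sum_comm (s := Finset.univ)]
    refine Finset.sum_congr rfl fun i _ => ?_
    rw [Finset.sum_comm (s := Finset.univ)]
    refine Finset.sum_congr rfl fun j _ => Finset.sum_congr rfl fun s _ => ?_
    ring
  rw [this]
  exact Finset.sum_nonneg fun s _ => mul_star_self_nonneg _

/-- Two finite families of vectors in `ℂⁿ` with the same Gram matrix are related by a unitary
matrix. -/
theorem exists_isometry_of_dotProduct_eq {ι n : Type*} [Fintype ι] [Fintype n] [DecidableEq n]
    (p q : ι → n → ℂ) (h : ∀ z w, star (p w) ⬝ᵥ p z = star (q w) ⬝ᵥ q z) :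
    ∃ M : Matrix n n ℂ, (∀ x y : n → ℂ, star (M *ᵥ x) ⬝ᵥ (M *ᵥ y) = star x ⬝ᵥ y) ∧
      ∀ z, M *ᵥ p z = q z := by
  let lin (p : ι → n → ℂ) : (ι → ℂ) →ₗ[ℂ] EuclideanSpace ℂ n :=
    Fintype.linearCombination ℂ fun i => WithLp.toLp 2 (p i)
  have hlin (p : ι → n → ℂ) (c : ι → ℂ) :
      ((‖lin p c‖ ^ 2 : ℝ) : ℂ) = ∑ i, ∑ j, star (c i) * c j * (star (p i) ⬝ᵥ p j) := by
    have := inner_self_eq_norm_sq_to_K (𝕜 := ℂ) (lin p c)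
    rw [Complex.ofReal_pow]
    refine this.symm.trans ?_
    simp only [lin, Fintype.linearCombination_apply, sum_inner, inner_sum, inner_smul_left,
      inner_smul_right, EuclideanSpace.inner_toLp_toLp, Finset.mul_sum]
    rw [Finset.sum_comm]
    refine Finset.sum_congr rfl fun i _ => Finset.sum_congr rfl fun j _ => ?_
    rw [dotProduct_comm, ← mul_assoc, mul_comm (c j)]
    rfl
  have hnorm (c : ι → ℂ) : ‖lin p c‖ = ‖lin q c‖ := by
    have : ((‖lin p c‖ ^ 2 : ℝ) : ℂ) = ((‖lin q c‖ ^ 2 : ℝ) : ℂ) := by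
      simp only [hlin, h]
    exact (sq_eq_sq₀ (norm_nonneg _) (norm_nonneg _)).1 (Complex.ofReal_injective this)
  obtain ⟨s, hs⟩ := (lin p).rangeRestrict.exists_rightInverse_of_surjective
    (LinearMap.range_rangeRestrict _)
  have hs' (y : LinearMap.range (lin p)) : lin p (s y) = y :=
    congrArg Subtype.val (LinearMap.congr_fun hs y)
  let V : LinearMap.range (lin p) →ₗᵢ[ℂ] EuclideanSpace ℂ n :=
    ⟨lin q ∘ₗ s, fun y => by
      rw [LinearMap.comp_apply, ← hnorm, hs']; rfl⟩
  let U := V.extend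
  have hU (c : ι → ℂ) : U (lin p c) = lin q c := by
    have h1 : U (lin p c) = lin q (s ⟨lin p c, c, rfl⟩) := V.extend_apply ⟨lin p c, c, rfl⟩
    rw [h1, ← sub_eq_zero, ← map_sub, ← norm_eq_zero, ← hnorm, map_sub, hs', sub_self, norm_zero]
  refine ⟨LinearMap.toMatrix' ((WithLp.linearEquiv 2 ℂ (n → ℂ)).toLinearMap ∘ₗ U.toLinearMap ∘ₗ
    (WithLp.linearEquiv 2 ℂ (n → ℂ)).symm.toLinearMap), fun x y => ?_, fun z => ?_⟩
  · simp only [LinearMap.toMatrix'_mulVec]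
    have := U.inner_map_map (WithLp.toLp 2 x) (WithLp.toLp 2 y)
    rw [EuclideanSpace.inner_toLp_toLp, EuclideanSpace.inner_eq_star_dotProduct] at this
    rw [dotProduct_comm, dotProduct_comm (star x)]
    exact this
  · classical
    rw [LinearMap.toMatrix'_mulVec]
    have := hU (Pi.single z 1)
    simp only [lin, Fintype.linearCombination_apply_single, one_smul] at this
    exact congrArg WithLp.ofLp this

section Realization

variable {d : ℕ} {N : Type*} [Fintype N] {M : Matrix (Option N) (Option N) ℂ} (π : N → Fin d)

/-- The vector `(a, Z x)`. -/
def inputVec (z : Fin d → ℂ) (a : ℂ) (x : N → ℂ) : Option N → ℂ :=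
  fun o => o.elim a fun i => z (π i) * x i

theorem eq_zero_of_mulVec_eq (hM : ∀ x y, star (M *ᵥ x) ⬝ᵥ (M *ᵥ y) = star x ⬝ᵥ y)
    {z : Fin d → ℂ} (hz : z ∈ polydisk d) {v : N → ℂ}
    (hv : ∀ i, v i = ∑ j, M (some i) (some j) * (z (π j) * v j)) : v = 0 := by
  set y := inputVec π z 0 v with hy
  have h1 : ∀ i, (M *ᵥ y) (some i) = v i := fun i => by
    rw [hv i, mulVec, dotProduct, Fintype.sum_option]
    simp [hy, inputVec]
  have h2 := congrArg Complex.re (hM y y)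
  simp only [dotProduct, Fintype.sum_option, h1, Pi.star_apply] at h2
  simp only [hy, inputVec, Option.elim, Complex.star_def, Complex.conj_mul', Complex.add_re,
    ← Complex.ofReal_pow, ← Complex.ofReal_sum, Complex.ofReal_re, norm_mul, norm_zero] at h2
  have h3 : ∑ i, (1 - ‖z (π i)‖ ^ 2) * ‖v i‖ ^ 2 ≤ 0 := by
    have : ∑ i, (1 - ‖z (π i)‖ ^ 2) * ‖v i‖ ^ 2 =
        ∑ i, ‖v i‖ ^ 2 - ∑ i, (‖z (π i)‖ * ‖v i‖) ^ 2 := by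
      rw [← Finset.sum_sub_distrib]
      exact Finset.sum_congr rfl fun _ _ => by ring
    rw [this]
    nlinarith [sq_nonneg ‖(M *ᵥ y) none‖]
  have hpos : ∀ i, 0 < 1 - ‖z (π i)‖ ^ 2 := fun i => by
    have := hz (π i)
    nlinarith [norm_nonneg (z (π i))]
  have h4 : ∀ i ∈ Finset.univ, 0 ≤ (1 - ‖z (π i)‖ ^ 2) * ‖v i‖ ^ 2 := fun i _ =>
    mul_nonneg (hpos i).le (sq_nonneg _)
  have h5 := (Finset.sum_eq_zero_iff_of_nonneg h4).1 (le_antisymm h3 (Finset.sum_nonneg h4))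
  ext i
  have := h5 i (Finset.mem_univ i)
  simpa [(hpos i).ne'] using this

variable [DecidableEq N]

variable (M) in
/-- The block matrix `1 - D Z` where `D` is the lower right block of `M` and `Z` is the diagonal
matrix whose entry at `i` is the variable with index `π i`. -/
noncomputable def pencil : Matrix N N (MvPolynomial (Fin d) ℂ) :=
  1 - Matrix.of fun i j => MvPolynomial.C (M (some i) (some j)) * MvPolynomial.X (π j)

variable (M) in
/-- The denominator `det (1 - D Z)` of the transfer function of `M`. -/
noncomputable def denom : MvPolynomial (Fin d) ℂ := (pencil M π).det

variable (M) in
/-- The vector `adj (1 - D Z) C`. -/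
noncomputable def stateVec : N → MvPolynomial (Fin d) ℂ :=
  (pencil M π).adjugate *ᵥ fun i => MvPolynomial.C (M (some i) none)

variable (M) in
/-- The numerator of the transfer function of `M`. -/
noncomputable def numer : MvPolynomial (Fin d) ℂ :=
  MvPolynomial.C (M none none) * denom M π +
    ∑ j, MvPolynomial.C (M none (some j)) * (MvPolynomial.X (π j) * stateVec M π j)

variable (M) in
theorem pencil_mulVec_stateVec (i : N) :
    stateVec M π i - ∑ j, MvPolynomial.C (M (some i) (some j)) *
      (MvPolynomial.X (π j) * stateVec M π j) = denom M π * MvPolynomial.C (M (some i) none) := by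
  have h : pencil M π *ᵥ stateVec M π =
      denom M π • fun i => MvPolynomial.C (M (some i) none) := by
    rw [stateVec, mulVec_mulVec, mul_adjugate, smul_mulVec, one_mulVec, denom]
  have := congrFun h i
  rw [pencil, sub_mulVec, one_mulVec] at this
  simpa [mulVec, dotProduct, mul_assoc] using this

variable (M) in
/-- `M` maps `(R, Z x)` to `(Q, x)`. -/
theorem mulVec_inputVec_denom (z : Fin d → ℂ) :
    M *ᵥ inputVec π z (MvPolynomial.eval z (denom M π))
      (fun i => MvPolynomial.eval z (stateVec M π i)) =
    fun o => o.elim (MvPolynomial.eval z (numer M π))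
      fun i => MvPolynomial.eval z (stateVec M π i) := by
  ext o
  rw [mulVec, dotProduct, Fintype.sum_option]
  cases o with
  | none => simp [inputVec, numer]
  | some i =>
    have := congrArg (MvPolynomial.eval z) (pencil_mulVec_stateVec M π i)
    simp only [map_sub, map_mul, map_sum, MvPolynomial.eval_C, MvPolynomial.eval_X] at this
    simp only [inputVec, Option.elim]
    rw [mul_comm, ← this]
    ring

theorem eval_denom_ne_zero (hM : ∀ x y, star (M *ᵥ x) ⬝ᵥ (M *ᵥ y) = star x ⬝ᵥ y)
    {z : Fin d → ℂ} (hz : z ∈ polydisk d) : MvPolynomial.eval z (denom M π) ≠ 0 := by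
  intro h
  rw [denom, RingHom.map_det] at h
  obtain ⟨v, hv0, hv⟩ := Matrix.exists_mulVec_eq_zero_iff.2 h
  refine hv0 (eq_zero_of_mulVec_eq π hM hz fun i => ?_)
  have h1 := congrFun hv i
  have h2 : (MvPolynomial.eval z).mapMatrix (pencil M π) =
      1 - Matrix.of fun i j => M (some i) (some j) * z (π j) := by
    rw [pencil, map_sub, map_one]
    congr 1
    ext i j
    simp
  rw [h2, sub_mulVec, one_mulVec] at h1
  simpa [mulVec, dotProduct, mul_assoc, sub_eq_zero] using h1

/-- The fundamental identity `R(w)* R(z) - Q(w)* Q(z) = ∑ (1 - w_j* z_j) x_j(w)* x_j(z)`. -/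
theorem star_denom_mul_denom_sub (hM : ∀ x y, star (M *ᵥ x) ⬝ᵥ (M *ᵥ y) = star x ⬝ᵥ y)
    (z w : Fin d → ℂ) :
    star (MvPolynomial.eval w (denom M π)) * MvPolynomial.eval z (denom M π) -
      star (MvPolynomial.eval w (numer M π)) * MvPolynomial.eval z (numer M π) =
    ∑ i, (1 - star (w (π i)) * z (π i)) *
      (star (MvPolynomial.eval w (stateVec M π i)) * MvPolynomial.eval z (stateVec M π i)) := by
  have h := hM (inputVec π w (MvPolynomial.eval w (denom M π))
      (fun i => MvPolynomial.eval w (stateVec M π i)))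
    (inputVec π z (MvPolynomial.eval z (denom M π))
      (fun i => MvPolynomial.eval z (stateVec M π i)))
  rw [mulVec_inputVec_denom, mulVec_inputVec_denom] at h
  simp only [dotProduct, Fintype.sum_option, Pi.star_apply, Option.elim, inputVec, star_mul'] at h
  have h' : ∀ i, (1 - star (w (π i)) * z (π i)) *
      (star (MvPolynomial.eval w (stateVec M π i)) * MvPolynomial.eval z (stateVec M π i)) =
      star (MvPolynomial.eval w (stateVec M π i)) * MvPolynomial.eval z (stateVec M π i) -
      star (w (π i)) * star (MvPolynomial.eval w (stateVec M π i)) *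
        (z (π i) * MvPolynomial.eval z (stateVec M π i)) := fun i => by ring
  simp only [h', Finset.sum_sub_distrib]
  linear_combination -h

theorem norm_eval_denom_eq (hM : ∀ x y, star (M *ᵥ x) ⬝ᵥ (M *ᵥ y) = star x ⬝ᵥ y)
    {z : Fin d → ℂ} (hz : z ∈ torus d) :
    ‖MvPolynomial.eval z (denom M π)‖ = ‖MvPolynomial.eval z (numer M π)‖ := by
  have h := star_denom_mul_denom_sub π hM z z
  have h1 : ∀ i, (1 - (‖z i‖ : ℂ) ^ 2) = 0 := fun i => by
    simp [hz i]
  simp only [Complex.star_def, Complex.conj_mul', h1, zero_mul, Finset.sum_const_zero,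
    sub_eq_zero] at h
  exact (sq_eq_sq₀ (norm_nonneg _) (norm_nonneg _)).1 (by exact_mod_cast h)

/-- If `M` maps `(1, Z u)` to `(a, u)`, then `a` is the value of the transfer function at `z`. -/
theorem numer_div_denom_eq (hM : ∀ x y, star (M *ᵥ x) ⬝ᵥ (M *ᵥ y) = star x ⬝ᵥ y)
    {z : Fin d → ℂ} (hz : z ∈ polydisk d) {a : ℂ} {u : N → ℂ}
    (hu : M *ᵥ inputVec π z 1 u = fun o => o.elim a u) :
    MvPolynomial.eval z (numer M π) / MvPolynomial.eval z (denom M π) = a := by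
  rw [div_eq_iff (eval_denom_ne_zero π hM hz)]
  have h1 := mulVec_inputVec_denom M π z
  set r := MvPolynomial.eval z (denom M π)
  set x := fun i => MvPolynomial.eval z (stateVec M π i)
  have hx : (fun i => x i - r * u i) = 0 := by
    refine eq_zero_of_mulVec_eq π hM hz fun i => ?_
    have h2 := congrFun h1 (some i)
    have h3 := congrFun hu (some i)
    simp only [mulVec, dotProduct, Fintype.sum_option, inputVec, Option.elim] at h2 h3
    rw [← h2, ← h3]
    simp only [mul_add, mul_sub, Finset.sum_sub_distrib, Finset.mul_sum]
    have : ∀ j, r * (M (some i) (some j) * (z (π j) * u j)) =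
      M (some i) (some j) * (z (π j) * (r * u j)) := fun j => by ring
    simp only [this]
    ring
  have hx' : ∀ i, x i = r * u i := fun i => sub_eq_zero.1 (congrFun hx i)
  have h2 := congrFun h1 none
  have h3 := congrFun hu none
  simp only [mulVec, dotProduct, Fintype.sum_option, inputVec, Option.elim] at h2 h3
  rw [← h2, ← h3]
  have : ∀ j, M none (some j) * (z (π j) * x j) =
      (M none (some j) * (z (π j) * u j)) * r := fun j => by rw [hx']; ring
  rw [add_mul, Finset.sum_mul]
  simp only [this]
  ring

variable (M) in
/-- The transfer function of `M` on the polydisk. -/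
noncomputable def transferFun (z : polydisk d) : ℂ :=
  MvPolynomial.eval (z : Fin d → ℂ) (numer M π) / MvPolynomial.eval (z : Fin d → ℂ) (denom M π)

variable (M) in
/-- The normalized state vector `x / R`. -/
noncomputable def state (z : polydisk d) (i : N) : ℂ :=
  MvPolynomial.eval (z : Fin d → ℂ) (stateVec M π i) /
    MvPolynomial.eval (z : Fin d → ℂ) (denom M π)

theorem one_sub_star_transferFun (hM : ∀ x y, star (M *ᵥ x) ⬝ᵥ (M *ᵥ y) = star x ⬝ᵥ y)
    (z w : polydisk d) :
    1 - star (transferFun M π w) * transferFun M π z =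
      ∑ i, (1 - star ((w : Fin d → ℂ) (π i)) * (z : Fin d → ℂ) (π i)) *
        (star (state M π w i) * state M π z i) := by
  have hz := eval_denom_ne_zero π hM z.2
  have hw := eval_denom_ne_zero π hM w.2
  have hw' := star_ne_zero.2 hw
  have h := star_denom_mul_denom_sub π hM z w
  simp only [transferFun, state, star_div₀]
  rw [div_mul_div_comm, one_sub_div (mul_ne_zero hw' hz), h, Finset.sum_div]
  refine Finset.sum_congr rfl fun i _ => ?_
  rw [div_mul_div_comm, mul_div_assoc]

theorem isRationalInner_transferFun
    (hM : ∀ x y, star (M *ᵥ x) ⬝ᵥ (M *ᵥ y) = star x ⬝ᵥ y) :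
    IsRationalInner (transferFun M π) :=
  ⟨numer M π, denom M π, fun _ hz => eval_denom_ne_zero π hM hz,
    fun _ hz => norm_eval_denom_eq π hM hz, fun _ => rfl⟩

theorem hasAglerDecomposition_transferFun
    (hM : ∀ x y, star (M *ᵥ x) ⬝ᵥ (M *ᵥ y) = star x ⬝ᵥ y) :
    HasAglerDecomposition (transferFun M π) := by
  refine ⟨fun j => Matrix.of fun z w => star (fun i : {i // π i = j} => state M π w i) ⬝ᵥ
    (fun i : {i // π i = j} => state M π z i), fun j => posSemidef_of_dotProduct_star _,
    fun z w => ?_⟩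
  rw [one_sub_star_transferFun π hM]
  simp only [of_apply, dotProduct, Pi.star_apply, Finset.mul_sum]
  rw [← Fintype.sum_fiberwise π]
  refine Finset.sum_congr rfl fun j _ => Finset.sum_congr rfl fun i _ => ?_
  rw [i.2]

theorem transferFun_norm_lt_one_or_const
    (hM : ∀ x y, star (M *ᵥ x) ⬝ᵥ (M *ᵥ y) = star x ⬝ᵥ y) :
    (∀ z, ‖transferFun M π z‖ < 1) ∨ ∃ c : ℂ, ‖c‖ = 1 ∧ ∀ z, transferFun M π z = c := by
  by_cases hlt : ∀ z, ‖transferFun M π z‖ < 1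
  · exact Or.inl hlt
  push Not at hlt
  obtain ⟨z, hz⟩ := hlt
  have h := congrArg Complex.re (one_sub_star_transferFun π hM z z)
  simp only [Complex.star_def, Complex.conj_mul', ← Complex.ofReal_pow, ← Complex.ofReal_one,
    ← Complex.ofReal_sub, ← Complex.ofReal_mul, ← Complex.ofReal_sum, Complex.ofReal_re] at h
  have hpos : ∀ i, 0 < 1 - ‖(z : Fin d → ℂ) i‖ ^ 2 := fun i => by
    have := z.2 i
    nlinarith [norm_nonneg ((z : Fin d → ℂ) i)]
  have h4 : ∀ i ∈ Finset.univ, 0 ≤ (1 - ‖(z : Fin d → ℂ) (π i)‖ ^ 2) * ‖state M π z i‖ ^ 2 :=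
    fun i _ => mul_nonneg (hpos _).le (sq_nonneg _)
  have h5 := (Finset.sum_eq_zero_iff_of_nonneg h4).1
    (le_antisymm (by rw [← h]; nlinarith) (Finset.sum_nonneg h4))
  have h6 : ∀ i, state M π z i = 0 := fun i => by
    have := h5 i (Finset.mem_univ i)
    simpa [(hpos _).ne'] using this
  have h7 : ∀ w, star (transferFun M π w) * transferFun M π z = 1 := fun w => by
    have := one_sub_star_transferFun π hM z w
    simp only [h6, mul_zero, Finset.sum_const_zero] at this
    exact (sub_eq_zero.1 this).symm
  have hz0 : transferFun M π z ≠ 0 := right_ne_zero_of_mul_eq_one (h7 z)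
  refine Or.inr ⟨transferFun M π z, ?_, fun w => ?_⟩
  · have := congrArg norm (h7 z)
    rw [norm_mul, norm_star, norm_one] at this
    nlinarith [norm_nonneg (transferFun M π z)]
  · exact star_injective (mul_right_cancel₀ hz0 ((h7 w).trans (h7 z).symm))

end Realization

/-- A decomposition on a finite set extends to a rational inner function with an Agler
decomposition. -/
theorem exists_rationalInner_of_decomposition {d : ℕ} {S : Finset (Fin d → ℂ)}
    (hS : ∀ z ∈ S, z ∈ polydisk d) {f : S → ℂ} {A : Fin d → Matrix S S ℂ}
    (hA : ∀ j, (A j).PosSemidef)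
    (h : ∀ z w : S, 1 - star (f w) * f z =
      ∑ j, (1 - star ((w : Fin d → ℂ) j) * (z : Fin d → ℂ) j) * A j z w) :
    ∃ φ : polydisk d → ℂ, IsRationalInner φ ∧
      ((∀ z, ‖φ z‖ < 1) ∨ ∃ c : ℂ, ‖c‖ = 1 ∧ ∀ z, φ z = c) ∧
      (∀ z : S, φ ⟨z, hS z z.2⟩ = f z) ∧ HasAglerDecomposition φ := by
  classical
  choose u hu using fun j => (hA j).exists_dotProduct_star
  obtain ⟨M, hM, hMp⟩ := exists_isometry_of_dotProduct_eq
    (fun z : S => inputVec (Prod.fst : Fin d × S → Fin d) (z : Fin d → ℂ) 1 fun i => u i.1 z i.2)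
    (fun z : S => fun o => o.elim (f z) fun i => u i.1 z i.2) (fun z w => by
      have := h z w
      simp only [hu, dotProduct, Pi.star_apply, Finset.mul_sum] at this
      simp only [dotProduct, Fintype.sum_option, Pi.star_apply, Option.elim, inputVec, star_mul',
        Fintype.sum_prod_type, star_one]
      have h' : ∀ j s, (1 - star ((w : Fin d → ℂ) j) * (z : Fin d → ℂ) j) *
          (star (u j w s) * u j z s) = star (u j w s) * u j z s -
          star ((w : Fin d → ℂ) j) * star (u j w s) * ((z : Fin d → ℂ) j * u j z s) :=
        fun j s => by ring
      simp only [h', Finset.sum_sub_distrib] at this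
      linear_combination this)
  exact ⟨transferFun M Prod.fst, isRationalInner_transferFun _ hM,
    transferFun_norm_lt_one_or_const _ hM,
    fun z => numer_div_denom_eq _ hM (hS z z.2) (hMp z),
    hasAglerDecomposition_transferFun _ hM⟩

section Contraction

variable {ι E : Type*} [Fintype ι] [NormedAddCommGroup E] [InnerProductSpace ℂ E]

/-- An operator that is diagonal in a basis is contractive if and only if the associated Pick-type
matrix is positive semidefinite. -/
theorem norm_le_one_iff_posSemidef (v : Module.Basis ι ℂ E) {F : E →L[ℂ] E} {g : ι → ℂ}
    (hF : ∀ a, F (v a) = g a • v a) :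
    ‖F‖ ≤ 1 ↔ (Matrix.of fun a b =>
      (1 - star (g a) * g b) * inner ℂ (v a) (v b)).PosSemidef := by
  have hG : (Matrix.of fun a b => (1 - star (g a) * g b) * inner ℂ (v a) (v b)) =
      gram ℂ v - gram ℂ fun a => F (v a) := by
    ext a b
    simp only [of_apply, Matrix.sub_apply, gram_apply, hF, inner_smul_left, inner_smul_right]
    rw [Complex.star_def]
    ring
  have hq (x : ι → ℂ) : star x ⬝ᵥ ((gram ℂ v - gram ℂ fun a => F (v a)) *ᵥ x) =
      ((‖∑ i, x i • v i‖ ^ 2 - ‖F (∑ i, x i • v i)‖ ^ 2 : ℝ) : ℂ) := by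
    rw [sub_mulVec, dotProduct_sub, star_dotProduct_gram_mulVec, star_dotProduct_gram_mulVec,
      map_sum]
    simp only [map_smul, inner_self_eq_norm_sq_to_K]
    push_cast
    rfl
  rw [hG, posSemidef_iff_dotProduct_mulVec]
  simp only [hq]
  constructor
  · intro h
    refine ⟨(isHermitian_gram ℂ _).sub (isHermitian_gram ℂ _), fun x => ?_⟩
    rw [Complex.zero_le_real, sub_nonneg]
    have := F.le_of_opNorm_le h (∑ i, x i • v i)
    rw [one_mul] at this
    gcongr
  · rintro ⟨-, h⟩
    refine F.opNorm_le_bound zero_le_one fun y => ?_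
    have := h (v.repr y)
    rw [v.sum_repr, Complex.zero_le_real, sub_nonneg] at this
    rw [one_mul]
    exact (sq_le_sq₀ (norm_nonneg _) (norm_nonneg _)).1 this

end Contraction

/-- A decomposition implies the von Neumann inequality for `f`. -/
theorem norm_applyFun_le_one {d k : ℕ} {S : Finset (Fin d → ℂ)} {f : S → ℂ}
    {A : Fin d → Matrix S S ℂ} (hA : ∀ j, (A j).PosSemidef)
    (h : ∀ z w : S, 1 - star (f w) * f z =
      ∑ j, (1 - star ((w : Fin d → ℂ) j) * (z : Fin d → ℂ) j) * A j z w)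
    {T : Fin d → Op k} (hT : IsSimpleDiagonalizableContraction T)
    (hTS : jointSpectrum T ⊆ (S : Set (Fin d → ℂ))) : ‖applyFun S f T‖ ≤ 1 := by
  have hF := isFunctionOf_applyFun S f T hT.diagonalizable hTS
  obtain ⟨b, hb⟩ := hT.diagonalizable
  choose c hc using hb
  have hmem : ∀ i, b i ∈ jointEigenspace T (c i) := fun i =>
    (mem_jointEigenspace T _ _).2 (hc i)
  have hcS : ∀ i, c i ∈ S := fun i => hTS fun h => b.ne_zero i (by
    have := hmem i
    rwa [h, Submodule.mem_bot] at this)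
  rw [norm_le_one_iff_posSemidef b (g := fun i => f ⟨c i, hcS i⟩)
    fun i => hF ⟨c i, hcS i⟩ (b i) (hmem i)]
  have hG (j : Fin d) := (norm_le_one_iff_posSemidef b fun i => hc i j).1 (hT.contractive j)
  have := posSemidef_sum Finset.univ fun j _ =>
    (((hA j).transpose.submatrix fun i : Fin k => (⟨c i, hcS i⟩ : S)).hadamard (hG j))
  refine (congrArg PosSemidef (Matrix.ext fun p q => ?_)).mpr this
  simp only [of_apply, h, Matrix.sum_apply, hadamard_apply, submatrix_apply, transpose_apply,
    Finset.sum_mul]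
  exact Finset.sum_congr rfl fun j _ => by ring

/-- A positive definite matrix is the Gram matrix of a basis of Euclidean space. -/
theorem exists_basis_gram_eq {ι : Type*} [Fintype ι] {H : Matrix ι ι ℂ} (hH : H.PosDef) :
    ∃ (k : ℕ) (b : Module.Basis ι ℂ (EuclideanSpace ℂ (Fin k))), gram ℂ b = H := by
  classical
  obtain ⟨u, hu⟩ := hH.posSemidef.exists_dotProduct_star
  let e := LinearIsometryEquiv.piLpCongrLeft 2 ℂ ℂ (Fintype.equivFin ι)
  let v : ι → EuclideanSpace ℂ (Fin (Fintype.card ι)) := fun a => e (WithLp.toLp 2 (star (u a)))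
  have hv : gram ℂ v = H := by
    ext a b
    rw [gram_apply, e.inner_map_map, EuclideanSpace.inner_toLp_toLp, star_star, hu]
  have hli : LinearIndependent ℂ v := linearIndependent_of_posDef_gram (hv.symm ▸ hH)
  refine ⟨_, Module.Basis.mk hli
    (hli.span_eq_top_of_card_eq_finrank' (by simp)).ge, ?_⟩
  rw [Module.Basis.coe_mk, hv]

/-- The von Neumann inequality for `f`, tested on the tuple that is diagonal in a basis indexed by
`S`. -/
theorem posSemidef_of_norm_applyFun_le_one {d k : ℕ} {S : Finset (Fin d → ℂ)} {f : S → ℂ}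
    (h : ∀ (k : ℕ) (T : Fin d → Op k), IsSimpleDiagonalizableContraction T →
      jointSpectrum T ⊆ (S : Set (Fin d → ℂ)) → ‖applyFun S f T‖ ≤ 1)
    (b : Module.Basis S ℂ (EuclideanSpace ℂ (Fin k)))
    (hb : ∀ j, (Matrix.of fun z w : S => (1 - star ((z : Fin d → ℂ) j) * (w : Fin d → ℂ) j) *
      gram ℂ b z w).PosSemidef) :
    (Matrix.of fun z w : S => (1 - star (f z) * f w) * gram ℂ b z w).PosSemidef := by
  classical
  let T : Fin d → Op k := fun j =>
    LinearMap.toContinuousLinearMap (b.constr ℂ fun z : S => (z : Fin d → ℂ) j • b z)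
  have hTb (j : Fin d) (z : S) : T j (b z) = (z : Fin d → ℂ) j • b z :=
    b.constr_basis ℂ (fun z : S => (z : Fin d → ℂ) j • b z) z
  have hTrepr (j : Fin d) (v) (z : S) : b.repr (T j v) z = (z : Fin d → ℂ) j * b.repr v z := by
    have h1 : T j v = ∑ l : S, (b.repr v l * (l : Fin d → ℂ) j) • b l := by
      conv_lhs => rw [← b.sum_repr v, map_sum]
      exact Finset.sum_congr rfl fun l _ => by rw [map_smul, hTb, smul_smul]
    rw [h1, b.repr_sum_self, mul_comm]
  have hsupp {z : Fin d → ℂ} {v} (hv : v ∈ jointEigenspace T z) (a : S)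
      (ha : b.repr v a ≠ 0) : (a : Fin d → ℂ) = z := by
    funext j
    have h1 := hTrepr j v a
    rw [(mem_jointEigenspace T z v).1 hv j, map_smul, Finsupp.smul_apply, smul_eq_mul] at h1
    exact (mul_right_cancel₀ ha h1).symm
  have hbmem (z : S) : b z ∈ jointEigenspace T z :=
    (mem_jointEigenspace T _ _).2 fun j => hTb j z
  have hspec : jointSpectrum T ⊆ (S : Set (Fin d → ℂ)) := by
    intro z hz
    obtain ⟨v, hv, hv0⟩ := Submodule.exists_mem_ne_zero_of_ne_bot hz
    obtain ⟨a, ha⟩ : ∃ a, b.repr v a ≠ 0 := by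
      by_contra! hcon
      exact hv0 (b.ext_elem fun i => by rw [hcon i]; simp)
    rw [← hsupp hv a ha]
    exact a.2
  have hT : IsSimpleDiagonalizableContraction T := by
    refine ⟨fun i j => ?_, fun j => (norm_le_one_iff_posSemidef b (hTb j)).2 (hb j), ?_, ?_⟩
    · refine ContinuousLinearMap.ext fun v => b.ext_elem fun a => ?_
      simp only [mul_apply_eq_comp, hTrepr]
      ring
    · let e : S ≃ Fin k := b.indexEquiv (EuclideanSpace.basisFun (Fin k) ℂ).toBasis
      exact ⟨b.reindex e, fun i j => ⟨_, by rw [b.reindex_apply]; exact hTb j _⟩⟩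
    · intro z hz
      lift z to S using hspec hz
      have : jointEigenspace T z = ℂ ∙ b z := by
        refine le_antisymm (fun v hv => ?_) ((Submodule.span_singleton_le_iff_mem _ _).2 (hbmem z))
        refine Submodule.mem_span_singleton.2 ⟨b.repr v z, b.ext_elem fun a => ?_⟩
        rw [map_smul, Finsupp.smul_apply, b.repr_self, smul_eq_mul]
        by_cases hza : z = a
        · subst hza; simp
        · rw [Finsupp.single_eq_of_ne (Ne.symm hza), mul_zero]
          by_contra hne
          exact hza (Subtype.ext (hsupp hv a (Ne.symm hne)).symm)
      rw [this, finrank_span_singleton (b.ne_zero z)]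
  have hF := isFunctionOf_applyFun S f T hT.diagonalizable hspec
  exact (norm_le_one_iff_posSemidef b fun z => hF z (b z) (hbmem z)).1 (h k T hT hspec)

section Cone

variable {ι J : Type*} [Fintype J]

/-- The convex cone of all sums `∑ γ_j A_j` (entrywise products) with `A_j` positive
semidefinite. -/
def kernelCone (γ : J → ι → ι → ℂ) : Set (ι → ι → ℂ) :=
  {P | ∃ A : J → ι → ι → ℂ, (∀ j, (Matrix.of (A j)).PosSemidef) ∧
    P = fun z w => ∑ j, γ j z w * A j z w}

theorem convex_kernelCone (γ : J → ι → ι → ℂ) : Convex ℝ (kernelCone γ) := by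
  rintro _ ⟨A, hA, rfl⟩ _ ⟨B, hB, rfl⟩ a b ha hb -
  refine ⟨a • A + b • B, fun j => ?_, ?_⟩
  · exact ((hA j).smul ha).add ((hB j).smul hb)
  · ext z w
    simp only [Pi.add_apply, Pi.smul_apply, mul_add, Finset.sum_add_distrib, Complex.real_smul,
      Finset.mul_sum]
    congr 1 <;> exact Finset.sum_congr rfl fun _ _ => by ring

variable [Fintype ι]

theorem isClosed_setOf_posSemidef : IsClosed {A : ι → ι → ℂ | (Matrix.of A).PosSemidef} := by
  simp only [posSemidef_iff_dotProduct_mulVec, Set.ofPred_and, Set.ofPred_forall]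
  refine IsClosed.inter ?_ (isClosed_iInter fun x => ?_)
  · have : {A : ι → ι → ℂ | (Matrix.of A).IsHermitian} =
        {A | (fun z w => star (A w z)) = A} := by
      ext A
      simp only [Set.mem_ofPred_eq, IsHermitian.ext_iff, funext_iff, of_apply]
    rw [this]
    exact isClosed_eq (by fun_prop) continuous_id
  · refine isClosed_le continuous_const ?_
    simp only [dotProduct, mulVec, of_apply]
    fun_prop

theorem _root_.Matrix.PosSemidef.norm_apply_le {A : Matrix ι ι ℂ} (hA : A.PosSemidef) {r : ℝ}
    (hr : ∀ z, (A z z).re ≤ r) (z w : ι) : ‖A z w‖ ≤ r := by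
  obtain ⟨u, hu⟩ := hA.exists_dotProduct_star
  have hin (z w : ι) : A z w = inner ℂ (WithLp.toLp 2 (u w)) (WithLp.toLp 2 (u z)) := by
    rw [hu, EuclideanSpace.inner_toLp_toLp, dotProduct_comm]
  have hn (z : ι) : ‖WithLp.toLp 2 (u z)‖ ^ 2 ≤ r := by
    refine le_trans (le_of_eq ?_) (hr z)
    rw [hin, ← inner_self_eq_norm_sq (𝕜 := ℂ)]
    rfl
  rw [hin]
  refine (norm_inner_le_norm _ _).trans ?_
  nlinarith [hn z, hn w, sq_nonneg (‖WithLp.toLp 2 (u z)‖ - ‖WithLp.toLp 2 (u w)‖)]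

theorem isClosed_kernelCone {γ : J → ι → ι → ℂ} (hγ : ∀ j z, 0 < γ j z z) :
    IsClosed (kernelCone γ) := by
  refine isClosed_of_closure_subset fun P hP => ?_
  obtain ⟨r, hr⟩ : ∃ r : ℝ, ∀ j z, (‖P‖ + 1) / (γ j z z).re ≤ r := by
    obtain ⟨r, hr⟩ := (Set.finite_range
      fun p : J × ι => (‖P‖ + 1) / (γ p.1 p.2 p.2).re).bddAbove
    exact ⟨r, fun j z => hr ⟨(j, z), rfl⟩⟩
  let K : Set (J → ι → ι → ℂ) :=
    Set.univ.pi (fun _ => {A : ι → ι → ℂ | (Matrix.of A).PosSemidef}) ∩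
      Set.univ.pi fun _ => Set.univ.pi fun _ => Set.univ.pi fun _ => Metric.closedBall 0 r
  have hK : IsCompact K :=
    (isCompact_univ_pi fun _ => isCompact_univ_pi fun _ => isCompact_univ_pi fun _ =>
      isCompact_closedBall _ _).inter_left (isClosed_set_pi fun _ _ => isClosed_setOf_posSemidef)
  let Φ : (J → ι → ι → ℂ) → ι → ι → ℂ := fun A z w => ∑ j, γ j z w * A j z w
  have hΦ : Continuous Φ := by fun_prop
  have hsub : Metric.ball P 1 ∩ kernelCone γ ⊆ Φ '' K := by
    rintro Q ⟨hQ, A, hA, rfl⟩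
    refine ⟨A, ⟨fun j _ => hA j, fun j _ z _ w _ => ?_⟩, rfl⟩
    rw [mem_closedBall_zero_iff]
    refine (hA j).norm_apply_le (fun z => (le_trans ?_ (hr j z))) z w
    obtain ⟨hpos, him⟩ := Complex.pos_iff.1 (hγ j z)
    rw [le_div_iff₀ hpos]
    have h1 : γ j z z * A j z z ≤ ∑ j, γ j z z * A j z z :=
      Finset.single_le_sum (f := fun j => γ j z z * A j z z)
        (fun j _ => mul_nonneg (hγ j z).le (hA j).diag_nonneg) (Finset.mem_univ j)
    have h2 := (Complex.le_def.1 h1).1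
    rw [Complex.mul_re, ← him, zero_mul, sub_zero] at h2
    have h3 : ‖fun z w => ∑ j, γ j z w * A j z w‖ ≤ ‖P‖ + 1 := by
      have := norm_le_norm_add_norm_sub' (fun z w => ∑ j, γ j z w * A j z w) P
      have h4 := (mem_ball_iff_norm.1 hQ).le
      linarith
    have h5 := (norm_le_pi_norm (fun z w => ∑ j, γ j z w * A j z w) z).trans h3
    have h6 := (norm_le_pi_norm (fun w => ∑ j, γ j z w * A j z w) z).trans h5
    have h7 := Complex.re_le_norm (∑ j, γ j z z * A j z z)
    rw [of_apply, mul_comm]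
    exact h2.trans (h7.trans h6)
  have h1 : P ∈ closure (Metric.ball P 1 ∩ kernelCone γ) :=
    Metric.isOpen_ball.inter_closure ⟨Metric.mem_ball_self one_pos, hP⟩
  obtain ⟨A, hA, hAP⟩ :=
    (hK.image hΦ).isClosed.closure_subset_iff.2 hsub h1
  exact ⟨A, fun j => hA.1 j trivial, hAP.symm⟩

/-- On Hermitian matrices, the real part of a linear functional is the pairing with a Hermitian
matrix. -/
theorem exists_isHermitian_re_eq [DecidableEq ι] (L : (ι → ι → ℂ) →ₗ[ℂ] ℂ) :
    ∃ H : Matrix ι ι ℂ, H.IsHermitian ∧ ∀ M : ι → ι → ℂ, (∀ z w, star (M z w) = M w z) →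
      ∑ z, ∑ w, M z w * H w z = ((L M).re : ℂ) := by
  let l : ι → ι → ℂ := fun z w => L (Pi.single z (Pi.single w 1))
  have hL (M : ι → ι → ℂ) : L M = ∑ z, ∑ w, M z w * l z w := by
    have : M = ∑ z, ∑ w, M z w • Pi.single z (Pi.single w (1 : ℂ)) := by
      ext a b
      simp [Finset.sum_apply, Pi.single_apply, Finset.sum_ite_eq, apply_ite, ite_apply]
    conv_lhs => rw [this]
    simp only [map_sum, map_smul, smul_eq_mul, l]
  refine ⟨Matrix.of fun a b => (l b a + star (l a b)) / 2, IsHermitian.ext fun a b => ?_,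
    fun M hM => ?_⟩
  · simp [add_comm]
  · have h1 : star (L M) = ∑ z, ∑ w, M z w * star (l w z) := by
      rw [hL, Finset.sum_comm]
      simp only [star_sum, star_mul', hM]
    have h2 : ((L M).re : ℂ) = (L M + star (L M)) / 2 := by
      rw [Complex.star_def, Complex.re_eq_add_conj]
    rw [h2, h1]
    conv_rhs => rw [hL]
    simp only [← Finset.sum_add_distrib, Finset.sum_div, of_apply]
    exact Finset.sum_congr rfl fun z _ => Finset.sum_congr rfl fun w _ => by ring

/-- A Hermitian matrix outside of the cone is separated from it by a Hermitian matrix. -/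
theorem exists_separating_of_notMem_kernelCone {γ : J → ι → ι → ℂ} (hγ : ∀ j z, 0 < γ j z z)
    (hγs : ∀ j z w, star (γ j z w) = γ j w z) {P : ι → ι → ℂ} (hPs : ∀ z w, star (P z w) = P w z)
    (hP : P ∉ kernelCone γ) :
    ∃ H : Matrix ι ι ℂ, H.IsHermitian ∧
      (∀ j, (Matrix.of fun a b => γ j b a * H a b).PosSemidef) ∧
      (∑ z, ∑ w, P z w * H w z).re < 0 := by
  classical
  obtain ⟨L, u, hL, hu⟩ := RCLike.geometric_hahn_banach_closed_point (𝕜 := ℂ)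
    (convex_kernelCone γ) (isClosed_kernelCone hγ) hP
  obtain ⟨H, hH, hHL⟩ := exists_isHermitian_re_eq (-L : (ι → ι → ℂ) →L[ℂ] ℂ).toLinearMap
  have hHL' (M : ι → ι → ℂ) (hM : ∀ z w, star (M z w) = M w z) :
      ∑ z, ∑ w, M z w * H w z = ((-(L M).re : ℝ) : ℂ) := hHL M hM
  have hu0 : 0 < u := by
    have := hL 0 ⟨0, fun _ => PosSemidef.zero, by ext; simp⟩
    simpa using this
  refine ⟨H, hH, fun j => .of_dotProduct_mulVec_nonneg ?_ fun x => ?_, ?_⟩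
  · refine IsHermitian.ext fun a b => ?_
    rw [of_apply, of_apply, star_mul', hγs, hH.apply]
  · let M : ι → ι → ℂ := fun z w => γ j z w * (x z * star (x w))
    have hMC (t : ℝ) (ht : 0 ≤ t) : t • M ∈ kernelCone γ := by
      let B : ι → ι → ℂ := fun z w => t * (x z * star (x w))
      have hB : (Matrix.of B).PosSemidef := by
        convert (posSemidef_vecMulVec_self_star x).smul ht using 1
        ext z w
        simp [B, vecMulVec_apply]
      refine ⟨Pi.single j B, fun i => ?_, ?_⟩
      · by_cases hij : i = j
        · subst hij
          rwa [Pi.single_eq_same]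
        · rw [Pi.single_eq_of_ne hij]
          exact PosSemidef.zero
      · ext z w
        rw [Finset.sum_eq_single j (fun i _ hij => by simp [Pi.single_eq_of_ne hij]) (by simp),
          Pi.single_eq_same]
        simp only [Pi.smul_apply, Complex.real_smul, M, B]
        ring
    have hLM : (L M).re ≤ 0 := by
      by_contra! hpos
      have := hL _ (hMC (u / (L M).re) (div_nonneg hu0.le hpos.le))
      rw [← Complex.coe_smul, map_smul] at this
      simp [hpos.ne'] at this
    have h1 := hHL' M fun z w => by
      simp only [M, star_mul', star_star, hγs]
      ring
    have h2 : star x ⬝ᵥ ((Matrix.of fun a b => γ j b a * H a b) *ᵥ x) =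
        ∑ z, ∑ w, M z w * H w z := by
      rw [Finset.sum_comm]
      simp only [dotProduct, mulVec, Finset.mul_sum, of_apply, M, Pi.star_apply]
      exact Finset.sum_congr rfl fun a _ => Finset.sum_congr rfl fun b _ => by ring
    rw [h2, h1, Complex.zero_le_real]
    linarith
  · rw [hHL' P hPs, Complex.ofReal_re]
    exact neg_lt_zero.2 (hu0.trans hu)

/-- If a strict diagonal contraction does not increase a Hermitian form, then the form is
positive semidefinite. -/
theorem posSemidef_of_one_sub_mul {l : ι → ℂ} (hl : ∀ a, ‖l a‖ < 1) {H : Matrix ι ι ℂ}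
    (hH : H.IsHermitian)
    (hG : (Matrix.of fun a b => (1 - star (l a) * l b) * H a b).PosSemidef) :
    H.PosSemidef := by
  refine .of_dotProduct_mulVec_nonneg hH fun x => ?_
  let q : (ι → ℂ) → ℂ := fun x => star x ⬝ᵥ (H *ᵥ x)
  have hq : Continuous q := by
    simp only [q, dotProduct, mulVec]
    fun_prop
  have hstep (x : ι → ℂ) : q (l * x) ≤ q x := by
    have h1 := hG.dotProduct_mulVec_nonneg x
    rw [← sub_nonneg]
    convert h1 using 1
    simp only [q, dotProduct, mulVec, Finset.mul_sum, of_apply, Pi.star_apply, Pi.mul_apply,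
      star_mul', ← Finset.sum_sub_distrib]
    exact Finset.sum_congr rfl fun a _ => Finset.sum_congr rfl fun b _ => by ring
  have hiter (n : ℕ) : q (l ^ n * x) ≤ q x := by
    induction n with
    | zero => simp
    | succ n ih =>
      rw [pow_succ', mul_assoc]
      exact (hstep _).trans ih
  have hlim : Filter.Tendsto (fun n : ℕ => q (l ^ n * x)) Filter.atTop (nhds (q 0)) := by
    refine (hq.tendsto 0).comp (tendsto_pi_nhds.2 fun a => ?_)
    have := (tendsto_pow_atTop_nhds_zero_of_norm_lt_one (hl a)).mul_const (x a)
    simpa using this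
  have := le_of_tendsto' hlim hiter
  simpa [q] using this

end Cone

/-- The von Neumann inequality for `f` implies the existence of a decomposition. -/
theorem exists_decomposition {d : ℕ} (hd : 0 < d) {S : Finset (Fin d → ℂ)}
    (hS : ∀ z ∈ S, z ∈ polydisk d) {f : S → ℂ}
    (h : ∀ (k : ℕ) (T : Fin d → Op k), IsSimpleDiagonalizableContraction T →
      jointSpectrum T ⊆ (S : Set (Fin d → ℂ)) → ‖applyFun S f T‖ ≤ 1) :
    ∃ A : Fin d → Matrix S S ℂ, (∀ j, (A j).PosSemidef) ∧
      ∀ z w : S, 1 - star (f w) * f z =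
        ∑ j, (1 - star ((w : Fin d → ℂ) j) * (z : Fin d → ℂ) j) * A j z w := by
  classical
  let γ : Fin d → S → S → ℂ := fun j z w => 1 - star ((w : Fin d → ℂ) j) * (z : Fin d → ℂ) j
  let P : S → S → ℂ := fun z w => 1 - star (f w) * f z
  have hγ (j : Fin d) (z : S) : 0 < γ j z z := by
    have h1 : ‖(z : Fin d → ℂ) j‖ < 1 := hS z z.2 j
    have h2 : γ j z z = ((1 - ‖(z : Fin d → ℂ) j‖ ^ 2 : ℝ) : ℂ) := by
      simp [γ, Complex.conj_mul']
    rw [h2, Complex.zero_lt_real]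
    nlinarith [norm_nonneg ((z : Fin d → ℂ) j)]
  suffices hP : P ∈ kernelCone γ by
    obtain ⟨A, hA, hPA⟩ := hP
    exact ⟨fun j => Matrix.of (A j), hA, fun z w => congrFun (congrFun hPA z) w⟩
  by_contra hP
  obtain ⟨H, hH, hHγ, hneg⟩ := exists_separating_of_notMem_kernelCone hγ
    (fun j z w => by simp [γ, mul_comm]) (fun z w => by simp [P, mul_comm]) hP
  have hH0 : H.PosSemidef := posSemidef_of_one_sub_mul
    (fun a : S => hS a a.2 ⟨0, hd⟩) hH (hHγ ⟨0, hd⟩)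
  have key (ε : ℝ) (hε : 0 < ε) :
      0 ≤ (∑ z, ∑ w, P z w * H w z).re + ε * (∑ z, P z z).re := by
    have hε' : (0 : ℂ) < ε := Complex.zero_lt_real.2 hε
    have hpd : (H + (ε : ℂ) • (1 : Matrix S S ℂ)).PosDef :=
      PosDef.posSemidef_add hH0 (PosDef.one.smul hε')
    obtain ⟨k, b, hb⟩ := exists_basis_gram_eq hpd
    have h1 := posSemidef_of_norm_applyFun_le_one h b fun j => by
      have h2 : (Matrix.diagonal fun z : S => (ε : ℂ) * γ j z z).PosSemidef :=
        PosSemidef.diagonal fun z => (mul_pos hε' (hγ j z)).le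
      convert (hHγ j).add h2 using 1
      ext z w
      rw [hb]
      by_cases hzw : z = w
      · subst hzw
        simp [γ]
        ring
      · simp [γ, hzw]
    have h2 := h1.dotProduct_mulVec_nonneg 1
    have h3 : star (1 : S → ℂ) ⬝ᵥ ((Matrix.of fun z w : S =>
        (1 - star (f z) * f w) * gram ℂ b z w) *ᵥ 1) =
        (∑ z, ∑ w, P z w * H w z) + ε * ∑ z, P z z := by
      rw [hb, Finset.sum_comm, Finset.mul_sum, ← Finset.sum_add_distrib]
      simp only [dotProduct, mulVec, of_apply, Pi.star_apply, Pi.one_apply, star_one, one_mul,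
        mul_one, Matrix.add_apply, Matrix.smul_apply, smul_eq_mul, mul_add, Finset.sum_add_distrib, one_apply,
        mul_ite, mul_zero, Finset.sum_ite_eq, Finset.mem_univ, if_true, P]
      congr 1
      exact Finset.sum_congr rfl fun z _ => mul_comm _ _
    rw [h3] at h2
    simpa using (Complex.le_def.1 h2).1
  set s := (∑ z, ∑ w, P z w * H w z).re
  set c := (∑ z, P z z).re
  have hc : 0 < |c| + 1 := by positivity
  have h1 := key (-s / (|c| + 1)) (div_pos (neg_pos.2 hneg) hc)
  have h2 : -s / (|c| + 1) * c ≤ -s / (|c| + 1) * |c| :=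
    mul_le_mul_of_nonneg_left (le_abs_self c) (div_pos (neg_pos.2 hneg) hc).le
  have h3 : -s / (|c| + 1) * |c| = -s - -s / (|c| + 1) := by
    field_simp
    ring
  have h4 := div_pos (neg_pos.2 hneg) hc
  linarith

end AglerPick

theorem theorem4 (d : ℕ) (hd : 0 < d) (S : Finset (Fin d → ℂ))
    (hS : ∀ z ∈ S, z ∈ AglerPick.polydisk d) (f : S → ℂ) :
    List.TFAE [
      ∀ (k : ℕ) (T : Fin d → AglerPick.Op k),
        AglerPick.IsSimpleDiagonalizableContraction T →
        AglerPick.jointSpectrum T ⊆ (S : Set (Fin d → ℂ)) →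
        ‖AglerPick.applyFun S f T‖ ≤ 1,
      ∃ A : Fin d → Matrix S S ℂ,
        (∀ j, (A j).PosSemidef) ∧
        ∀ z w : S, 1 - star (f w) * f z =
          ∑ j, (1 - star ((w : Fin d → ℂ) j) * (z : Fin d → ℂ) j) * A j z w,
      ∃ φ : AglerPick.polydisk d → ℂ,
        AglerPick.IsRationalInner φ ∧
        ((∀ z, ‖φ z‖ < 1) ∨ ∃ c : ℂ, ‖c‖ = 1 ∧ ∀ z, φ z = c) ∧
        (∀ z : S, φ ⟨z, hS z z.2⟩ = f z) ∧
        AglerPick.HasAglerDecomposition φ] := by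
  tfae_have 1 → 2 := AglerPick.exists_decomposition hd hS
  tfae_have 2 → 1 := fun ⟨_, hA, h⟩ _ _ hT hTS => AglerPick.norm_applyFun_le_one hA h hT hTS
  tfae_have 2 → 3 := fun ⟨_, hA, h⟩ => AglerPick.exists_rationalInner_of_decomposition hS hA h
  tfae_have 3 → 2 := by
    rintro ⟨φ, -, -, hφ, K, hK, h⟩
    refine ⟨fun j => (K j).submatrix (fun z : S => ⟨z, hS z z.2⟩) fun z : S => ⟨z, hS z z.2⟩,
      fun j => (hK j).submatrix _, fun z w => ?_⟩
    rw [← hφ z, ← hφ w, h]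
    rfl
  tfae_finish
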